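/- A simple graph $G=(V,E)$ is a *threshold graph* if there are $w:V\to[0,\infty)$ and $t\ge 0$ such that a set $X\subseteq V$ is independent if and only if $\sum_{v\in X}w(v)\le t$. For a binary string $b=b_1\cdots b_m$ with $b_1=0$, let $G(b)$ be the graph on $v_1,\dots,v_m$ in which, for $i<j$, $v_i$ and $v_j$ are adjacent if and only if $b_j=1$; every connected threshold graph with at least two vertices is isomorphic to $G(b)$ for a unique such $b$, which has the form $b=0^{s_1}1^{t_1}\cdots 0^{s_k}1^{t_k}$ with $k\ge 1$ and all $s_i,t_i\ge 1$. Let $A_n=G(0101\cdots 01)$ for $n\geq 2$ even and $A_n=G(00101\cdots 01)$ for $n\geq 3$ odd, the strings having length $n$; this is the connected anti-regular graph on $n$ vertices, i.e. the unique connected $n$-vertex graph whose vertices have exactly $n-1$ distinct degrees. For a graph $G$, let $\mu^-(G)$ be the largest eigenvalue of the $(0,1)$-adjacency matrix of $G$ that is less than $-1$ (when such an eigenvalue exists), and let $\mu^+(G)$ be its smallest positive eigenvalue. **Theorem.** Let $n\ge 3$ be odd. Then $\mu^-(A_n)$ and $\mu^+(A_n)$ exist, and the following hold. (i) $\mu^-(G)\le\mu^-(A_n)$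 for every threshold graph $G$ on $n$ vertices for which $\mu^-(G)$ exists. (ii) If $G$ is a threshold graph on $n$ vertices with binary string $0^{s_1}1^{t_1}\cdots 0^{s_k}1^{t_k}$ ($k\ge 1$, all $s_i,t_i\ge 1$) and $s_1\ge 2$, then $\mu^+(G)$ exists and $\mu^+(A_n)\le\mu^+(G)$. (iii) If $G$ is a threshold graph on $n$ vertices with binary string $0^{s_1}1^{t_1}\cdots 0^{s_k}1^{t_k}$ ($k\ge 1$, all $s_i,t_i\ge 1$), $s_1=1$ and $2k+1<n$, then $\mu^+(G)$ exists and $\mu^+(A_n)\le\mu^+(G)$. -/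

import Mathlib

/-- `G` is a threshold graph: there are nonnegative vertex weights and a threshold `t ≥ 0` such
that a set of vertices is independent exactly when its total weight is at most `t`. -/
def IsThreshold {V : Type*} [Fintype V] (G : SimpleGraph V) : Prop :=
  ∃ w : V → ℝ, (∀ v, 0 ≤ w v) ∧ ∃ t : ℝ, 0 ≤ t ∧
    ∀ X : Finset V, G.IsIndepSet (X : Set V) ↔ ∑ v ∈ X, w v ≤ t

/-- The graph `G(b)` of a binary string `b` (`false` is the letter 0, `true` the letter 1): the
vertices are added one at a time, and the vertex at position `j` is joined to all earlier vertices
if the letter at position `j` is 1, and to none of them if it is 0. Hence two distinct vertices are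
adjacent iff the letter of the later one is 1. (The first letter plays no role.) -/
def stringGraph (b : List Bool) : SimpleGraph (Fin b.length) where
  Adj i j := i ≠ j ∧ b.get (max i j) = true
  symm := ⟨fun i j h => ⟨h.1.symm, by rw [max_comm]; exact h.2⟩⟩
  loopless := ⟨fun _ h => h.1 rfl⟩

/-- The binary string `0^{s_1} 1^{t_1} ⋯ 0^{s_k} 1^{t_k}`; the indices run from `0` to `k - 1`. -/
def blockString {k : ℕ} (s t : Fin k → ℕ) : List Bool :=
  (List.finRange k).flatMap fun i => List.replicate (s i) false ++ List.replicate (t i) true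

/-- The alternating string of length `n` that ends in 1: `0101⋯01` for even `n` and
`00101⋯01` for odd `n`. -/
def antiregularString : ℕ → List Bool
  | 0 => []
  | 1 => [false]
  | n + 2 => antiregularString n ++ [false, true]

/-- The connected anti-regular graph `A_n` on `n` vertices. -/
def antiregularGraph (n : ℕ) : SimpleGraph (Fin (antiregularString n).length) :=
  stringGraph (antiregularString n)

theorem length_antiregularString (n : ℕ) : (antiregularString n).length = n := by
  induction n using Nat.twoStepInduction with
  | zero => rfl
  | one => rfl
  | more n ih _ => simp [antiregularString, ih]

open Classical in
/-- `x` is an eigenvalue of the `(0,1)`-adjacency matrix of `G`. -/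
def IsGraphEigenvalue {V : Type*} [Fintype V] (G : SimpleGraph V) (x : ℝ) : Prop :=
  Module.End.HasEigenvalue (Matrix.toLin' (G.adjMatrix ℝ)) x

/-- `x = μ⁻(G)`: `x` is the largest eigenvalue of `G` less than `-1`. -/
def IsMuMinus {V : Type*} [Fintype V] (G : SimpleGraph V) (x : ℝ) : Prop :=
  IsGreatest {y : ℝ | IsGraphEigenvalue G y ∧ y < -1} x

/-- `x = μ⁺(G)`: `x` is the smallest positive eigenvalue of `G`. -/
def IsMuPlus {V : Type*} [Fintype V] (G : SimpleGraph V) (x : ℝ) : Prop :=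
  IsLeast {y : ℝ | IsGraphEigenvalue G y ∧ 0 < y} x

/-! Write n = 2K+1. All comparisons go through positive indices of shifted quadratic forms. If M has
positive index at least K and all its positive eigenvalues exceed c > 0, then M - c still has
positive index at least K. Suppose this forces N - c to have index at least k, while N itself has
index at most k. Then c is not an eigenvalue of N, because its eigenvector would add one more
positive direction for N. This is `Matrix.least_pos_le_of_hasPos`. It is used with adjacency
matrices A for μ⁺, and with -(A + I) for μ⁻, since the positive eigenvalues of the latter are -1 - y
for the eigenvalues y < -1 of A.

The index is passed between strings as follows. A subsequence gives an induced subgraph, so indices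
can only grow (`HasPos.of_sublist`). Shortening the alternating string by two letters costs at most
one (`HasPos.altRev_of_le`). In (ii) the string of G contains the alternating string of length 2k+1.
In (iii) it is only known to contain the one of length 2k; this arises from length 2k+3 by removing
the initial path on three vertices, at the cost of one dimension instead of the three naively
expected (`HasPos.of_prefix_path`), and 2k+1 < n leaves room for it. In (i) a scan of the string
finds k with the alternating string of length 2k+1 inside and at most k eigenvalues below -1
(`exists_altRev_sublist_and_not_hasPos`).

The remaining counts are `hasPos_altRev`, `hasPos_neg_altRev` and `not_hasPos_blockString`. -/

/-- A function `F` on a real vector space is positive away from zero on a `d`-dimensional space,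
given as the image of a linear map. For a quadratic form: its positive index is at least `d`. -/
def HasPos {E : Type*} [AddCommGroup E] [Module ℝ E] (F : E → ℝ) (d : ℕ) : Prop :=
  ∃ f : (Fin d → ℝ) →ₗ[ℝ] E, ∀ y, y ≠ 0 → 0 < F (f y)

namespace HasPos

variable {E E' : Type*} [AddCommGroup E] [Module ℝ E] [AddCommGroup E'] [Module ℝ E']

theorem transfer {F : E → ℝ} {F' : E' → ℝ} {d : ℕ} (h : HasPos F d) (g : E →ₗ[ℝ] E')
    (hg : ∀ x, F x ≤ F' (g x)) : HasPos F' d := by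
  obtain ⟨f, hf⟩ := h
  exact ⟨g ∘ₗ f, fun y hy => (hf y hy).trans_le (hg _)⟩

/-- A hyperplane meets a positive space in codimension at most one. Deleting pairs, blocks or the
initial path therefore costs only one dimension. -/
theorem transfer_ker {F : E → ℝ} {F' : E' → ℝ} {d : ℕ} (h : HasPos F (d + 1)) (g : E →ₗ[ℝ] E')
    (φ : E →ₗ[ℝ] ℝ) (hg : ∀ x, φ x = 0 → F x ≤ F' (g x)) : HasPos F' d := by
  obtain ⟨f, hf⟩ := h
  have hdim : Module.finrank ℝ (Fin d → ℝ) ≤ Module.finrank ℝ (LinearMap.ker (φ ∘ₗ f)) := by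
    have h1 := LinearMap.finrank_range_add_finrank_ker (φ ∘ₗ f)
    have h2 := Submodule.finrank_le (LinearMap.range (φ ∘ₗ f))
    simp only [Module.finrank_self, Module.finrank_fin_fun] at *
    omega
  obtain ⟨e, he⟩ := (finrank_le_iff_exists_linearMap).1 hdim
  refine ⟨g ∘ₗ f ∘ₗ (Submodule.subtype _) ∘ₗ e, fun y hy => ?_⟩
  have h1 : ((e y : _) : Fin (d + 1) → ℝ) ≠ 0 := by
    intro h0
    apply hy
    apply he
    rw [map_zero]
    exact Subtype.ext h0
  refine (hf _ h1).trans_le (hg _ ?_)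
  exact (e y).2

theorem le_of_ker {F : E → ℝ} {d k : ℕ} (h : HasPos F d) (g : E →ₗ[ℝ] (Fin k → ℝ))
    (hg : ∀ x, g x = 0 → F x ≤ 0) : d ≤ k := by
  by_contra! hlt
  obtain ⟨f, hf⟩ := h
  have hne : LinearMap.ker (g ∘ₗ f) ≠ ⊥ :=
    LinearMap.ker_ne_bot_of_finrank_lt (by simpa using hlt)
  obtain ⟨y, hy, hy0⟩ := (Submodule.ne_bot_iff _).1 hne
  exact absurd (hg _ hy) (not_le.2 (hf y hy0))

theorem mono {F : E → ℝ} {d d' : ℕ} (h : HasPos F d) (hd : d' ≤ d) : HasPos F d' := by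
  obtain ⟨f, hf⟩ := h
  have hdim : Module.finrank ℝ (Fin d' → ℝ) ≤ Module.finrank ℝ (Fin d → ℝ) := by simpa using hd
  obtain ⟨e, he⟩ := (finrank_le_iff_exists_linearMap).1 hdim
  exact ⟨f ∘ₗ e, fun y hy => hf _ (fun h0 => hy (he (h0.trans (map_zero e).symm)))⟩

end HasPos

/-! ### Positive index and least positive eigenvalue of symmetric matrices -/

namespace Matrix

variable {V : Type*} [Fintype V]

/-- The quadratic form of the matrix `M - c I`. -/
def shiftForm (M : Matrix V V ℝ) (c : ℝ) (x : V → ℝ) : ℝ := x ⬝ᵥ M *ᵥ x - c * (x ⬝ᵥ x)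

/-- `M` has a nonzero vector of eigenvalue `μ`. -/
def HasEig (M : Matrix V V ℝ) (μ : ℝ) : Prop := ∃ v : V → ℝ, v ≠ 0 ∧ M *ᵥ v = μ • v

/-- The form of M - μ does not change along v, because v lies in its kernel and M is symmetric. -/
theorem shiftForm_add_smul {M : Matrix V V ℝ} (hM : M.IsSymm) {μ : ℝ} {v : V → ℝ}
    (hv : M *ᵥ v = μ • v) (x : V → ℝ) (t : ℝ) :
    shiftForm M 0 (x + t • v) = shiftForm M μ x + μ * ((x + t • v) ⬝ᵥ (x + t • v)) := by
  have h1 : v ⬝ᵥ M *ᵥ x = μ * (x ⬝ᵥ v) := by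
    rw [dotProduct_mulVec, ← mulVec_transpose, hM.eq, hv, smul_dotProduct, smul_eq_mul,
      dotProduct_comm]
  simp only [shiftForm, mulVec_add, mulVec_smul, add_dotProduct, dotProduct_add, smul_dotProduct,
    dotProduct_smul, h1, hv, smul_eq_mul, dotProduct_comm v x]
  ring

theorem dotProduct_self_pos' {x : V → ℝ} (hx : x ≠ 0) : 0 < x ⬝ᵥ x := by
  have h := dotProduct_star_self_pos_iff (v := x)
  simpa using h.2 hx

/-- By `shiftForm_add_smul`, the form of M at u + t v is that of M - μ at u plus μ|u + t v|². Both
terms are nonnegative; for u ≠ 0 the first is positive, since μ ≤ c, and for u = 0 the second is. -/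
theorem hasPos_succ_of_hasEig {M : Matrix V V ℝ} (hM : M.IsSymm) {c μ : ℝ} {k : ℕ}
    (h : HasPos (shiftForm M c) k) (hμ : HasEig M μ) (h0 : 0 < μ) (hc : μ ≤ c) :
    HasPos (shiftForm M 0) (k + 1) := by
  obtain ⟨f, hf⟩ := h
  obtain ⟨v, hv0, hv⟩ := hμ
  let g : (Fin (k + 1) → ℝ) →ₗ[ℝ] (V → ℝ) :=
    f ∘ₗ LinearMap.funLeft ℝ ℝ Fin.succ + (LinearMap.proj 0).smulRight v
  refine ⟨g, fun y hy => ?_⟩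
  have hg : g y = f (fun i => y i.succ) + y 0 • v := rfl
  rw [hg, shiftForm_add_smul hM hv]
  by_cases ht : (fun i => y i.succ) = (0 : Fin k → ℝ)
  · have hy0 : y 0 ≠ 0 := by
      intro h0
      apply hy
      funext i
      refine Fin.cases h0 (fun i => congrFun ht i) i
    rw [ht, map_zero, zero_add]
    have h1 : shiftForm M μ (0 : V → ℝ) = 0 := by simp [shiftForm]
    rw [h1, zero_add]
    exact mul_pos h0 (dotProduct_self_pos' (smul_ne_zero hy0 hv0))
  · have h1 := hf _ ht
    set u := f (fun i => y i.succ)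
    have h2 : 0 ≤ u ⬝ᵥ u := by
      by_cases hu : u = 0
      · simp [hu]
      · exact (dotProduct_self_pos' hu).le
    have h3 : 0 ≤ (u + y 0 • v) ⬝ᵥ (u + y 0 • v) := by
      by_cases hu : u + y 0 • v = 0
      · simp [hu]
      · exact (dotProduct_self_pos' hu).le
    have h4 : 0 < shiftForm M μ u := by
      simp only [shiftForm] at h1 ⊢
      nlinarith
    have := mul_nonneg h0.le h3
    linarith

theorem exists_diagonalization {M : Matrix V V ℝ} (hM : M.IsSymm) :
    ∃ (l : V → ℝ) (e : (V → ℝ) ≃ₗ[ℝ] (V → ℝ)), (∀ i, HasEig M (l i)) ∧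
      ∀ c x, shiftForm M c x = ∑ i, (l i - c) * e x i ^ 2 := by
  classical
  have hH : M.IsHermitian := by
    rw [IsHermitian, conjTranspose_eq_transpose_of_trivial]
    exact hM
  let b := hH.eigenvectorBasis
  let e : (V → ℝ) ≃ₗ[ℝ] (V → ℝ) :=
    (WithLp.linearEquiv 2 ℝ (V → ℝ)).symm ≪≫ₗ b.repr.toLinearEquiv ≪≫ₗ
      (WithLp.linearEquiv 2 ℝ (V → ℝ))
  have he : ∀ x i, e x i = (b i).ofLp ⬝ᵥ x := by
    intro x i
    have : e x i = inner ℝ (b i) (WithLp.toLp 2 x) := by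
      rw [← b.repr_apply_apply]; rfl
    rw [this, EuclideanSpace.inner_eq_star_dotProduct]
    simp [dotProduct_comm]
  have hdot : ∀ x y : V → ℝ, x ⬝ᵥ y = ∑ i, e x i * e y i := by
    intro x y
    have h := b.sum_inner_mul_inner (WithLp.toLp 2 x) (WithLp.toLp 2 y)
    have h1 : inner ℝ (WithLp.toLp 2 x) (WithLp.toLp 2 y) = x ⬝ᵥ y := by
      rw [EuclideanSpace.inner_eq_star_dotProduct]
      simp [dotProduct_comm]
    rw [← h1, ← h]
    refine Finset.sum_congr rfl fun i _ => ?_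
    rw [he, he, EuclideanSpace.inner_eq_star_dotProduct, EuclideanSpace.inner_eq_star_dotProduct]
    simp [dotProduct_comm]
  refine ⟨hH.eigenvalues, e, fun i => ⟨(b i).ofLp, ?_, hH.mulVec_eigenvectorBasis i⟩, ?_⟩
  · intro h0
    have := b.orthonormal.ne_zero i
    exact this (by ext j; exact congrFun h0 j)
  · intro c x
    have hMx : ∀ i, e (M *ᵥ x) i = hH.eigenvalues i * e x i := by
      intro i
      rw [he, he, dotProduct_mulVec, ← mulVec_transpose, hM.eq, hH.mulVec_eigenvectorBasis i,
        smul_dotProduct, smul_eq_mul]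
    rw [shiftForm, hdot x, hdot x x, Finset.mul_sum, ← Finset.sum_sub_distrib]
    refine Finset.sum_congr rfl fun i _ => ?_
    rw [hMx]
    ring

/-- Project the positive space onto the span of the eigenvectors with positive eigenvalue. No
nonzero vector is lost, since its form would otherwise be nonpositive, and on the image M - c is
positive by the gap. -/
theorem hasPos_shiftForm_of_gap {M : Matrix V V ℝ} (hM : M.IsSymm) {c : ℝ} {k : ℕ}
    (h : HasPos (shiftForm M 0) k) (hgap : ∀ μ, HasEig M μ → 0 < μ → c < μ) :
    HasPos (shiftForm M c) k := by
  classical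
  obtain ⟨l, e, hl, he⟩ := exists_diagonalization hM
  obtain ⟨f, hf⟩ := h
  let m : (V → ℝ) →ₗ[ℝ] (V → ℝ) :=
    LinearMap.pi fun i => if 0 < l i then LinearMap.proj i else 0
  have hm : ∀ z i, m z i = if 0 < l i then z i else 0 := by
    intro z i
    by_cases h : 0 < l i <;> simp [m, h]
  refine ⟨e.symm.toLinearMap ∘ₗ m ∘ₗ e.toLinearMap ∘ₗ f, fun y hy => ?_⟩
  have hpos := hf y hy
  simp only [LinearMap.comp_apply, LinearEquiv.coe_coe]
  rw [he] at hpos ⊢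
  simp only [LinearEquiv.apply_symm_apply, hm]
  obtain ⟨i, -, hi⟩ := Finset.exists_lt_of_sum_lt (s := Finset.univ) (f := fun _ => (0 : ℝ))
    (g := fun i => (l i - 0) * e (f y) i ^ 2) (by simpa using hpos)
  have hli : 0 < l i := by
    by_contra hneg
    nlinarith [sq_nonneg (e (f y) i)]
  have hei : e (f y) i ≠ 0 := by
    intro h0
    simp [h0] at hi
  refine Finset.sum_pos' (fun j _ => ?_) ⟨i, Finset.mem_univ _, ?_⟩
  · by_cases hj : 0 < l j
    · have := hgap _ (hl j) hj
      simp only [hj, if_true]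
      exact mul_nonneg (by linarith) (sq_nonneg _)
    · simp [hj]
  · have := hgap _ (hl i) hli
    simp only [hli, if_true]
    exact mul_pos (by linarith) (by positivity)

theorem exists_pos_hasEig {M : Matrix V V ℝ} (hM : M.IsSymm) (h : HasPos (shiftForm M 0) 1) :
    ∃ μ, HasEig M μ ∧ 0 < μ := by
  obtain ⟨l, e, hl, he⟩ := exists_diagonalization hM
  obtain ⟨f, hf⟩ := h
  have hpos := hf 1 one_ne_zero
  rw [he] at hpos
  obtain ⟨i, -, hi⟩ := Finset.exists_lt_of_sum_lt (s := Finset.univ) (f := fun _ => (0 : ℝ))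
    (g := fun i => (l i - 0) * e (f 1) i ^ 2) (by simpa using hpos)
  refine ⟨l i, hl i, ?_⟩
  by_contra hneg
  nlinarith [sq_nonneg (e (f 1) i)]

theorem hasEigenvalue_toLin'_iff [DecidableEq V] (M : Matrix V V ℝ) (μ : ℝ) :
    Module.End.HasEigenvalue (Matrix.toLin' M) μ ↔ HasEig M μ := by
  constructor
  · intro h
    obtain ⟨v, hv⟩ := h.exists_hasEigenvector
    exact ⟨v, hv.2, by simpa using hv.apply_eq_smul⟩
  · rintro ⟨v, hv0, hv⟩
    exact Module.End.hasEigenvalue_of_hasEigenvector (x := v)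
      ⟨Module.End.mem_eigenspace_iff.2 (by simpa using hv), hv0⟩

theorem exists_isLeast_pos_hasEig {M : Matrix V V ℝ} (hM : M.IsSymm)
    (h : HasPos (shiftForm M 0) 1) : ∃ a, IsLeast {μ | HasEig M μ ∧ 0 < μ} a := by
  classical
  have hfin : {μ | HasEig M μ ∧ 0 < μ}.Finite := by
    refine (Module.End.finite_hasEigenvalue (Matrix.toLin' M)).subset ?_
    rintro μ ⟨hμ, -⟩
    exact (hasEigenvalue_toLin'_iff M μ).2 hμ
  obtain ⟨a, ha⟩ := hfin.exists_minimal (exists_pos_hasEig hM h)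
  exact ⟨a, ha.1, fun b hb => (le_total a b).elim id fun hba => ha.2 hb hba⟩

/-- Comparison of the least positive eigenvalues of two symmetric matrices. -/
theorem least_pos_le_of_hasPos {W : Type*} [Fintype W] {M : Matrix V V ℝ} {N : Matrix W W ℝ}
    (hM : M.IsSymm) (hN : N.IsSymm) {K k : ℕ} (hK : HasPos (shiftForm M 0) K)
    (hcomp : ∀ c, 0 < c → HasPos (shiftForm M c) K → HasPos (shiftForm N c) k)
    (hk : ¬ HasPos (shiftForm N 0) (k + 1)) {a g : ℝ}
    (ha : IsLeast {μ | HasEig M μ ∧ 0 < μ} a) (hg : HasEig N g) (hg0 : 0 < g) : a ≤ g := by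
  by_contra! hlt
  -- The shift is the offending eigenvalue g itself, hence the equality case of `μ ≤ c`.
  refine hk (hasPos_succ_of_hasEig hN (hcomp g hg0 ?_) hg hg0 le_rfl)
  exact hasPos_shiftForm_of_gap hM hK fun μ hμ h0 => hlt.trans_le (ha.2 ⟨hμ, h0⟩)

end Matrix

/-! ### Quadratic forms of strings and their comparison -/

/-- The quadratic form `σ xᵀ A x - c xᵀ x`, where `A` is the adjacency matrix of the graph with
string `l.reverse`: the head of `l` belongs to the last vertex. -/
def stringForm (σ c : ℝ) : (l : List Bool) → (Fin l.length → ℝ) → ℝ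
  | [], _ => 0
  | b :: l, x =>
    let y : Fin (l.length + 1) → ℝ := x
    stringForm σ c l (fun i => y i.succ) +
      (if b then 2 * σ * y 0 * ∑ i : Fin l.length, y i.succ else 0) - c * y 0 ^ 2

theorem stringForm_cons (σ c : ℝ) (b : Bool) (l : List Bool) (y : Fin (l.length + 1) → ℝ) :
    stringForm σ c (b :: l) y = stringForm σ c l (fun i => y i.succ) +
      (if b then 2 * σ * y 0 * ∑ i : Fin l.length, y i.succ else 0) - c * y 0 ^ 2 := rfl

/-- The sum of the coordinates, as a linear form. -/
def sumMap (m : ℕ) : (Fin m → ℝ) →ₗ[ℝ] ℝ := ∑ i, LinearMap.proj i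

theorem sumMap_apply {m : ℕ} (x : Fin m → ℝ) : sumMap m x = ∑ i, x i := by
  simp [sumMap]

theorem sumMap_succ {m : ℕ} (x : Fin (m + 1) → ℝ) :
    sumMap (m + 1) x = x 0 + sumMap m (fun i => x i.succ) := by
  simp [sumMap_apply, Fin.sum_univ_succ]

theorem stringForm_true (σ c : ℝ) (l : List Bool) (y : Fin (l.length + 1) → ℝ) :
    stringForm σ c (true :: l) y = stringForm σ c l (fun i => y i.succ) +
      2 * σ * y 0 * sumMap l.length (fun i => y i.succ) - c * y 0 ^ 2 := by
  simp [stringForm_cons, sumMap_apply]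

theorem stringForm_false (σ c : ℝ) (l : List Bool) (y : Fin (l.length + 1) → ℝ) :
    stringForm σ c (false :: l) y = stringForm σ c l (fun i => y i.succ) - c * y 0 ^ 2 := by
  simp [stringForm_cons]

/-- Forgetting the head coordinate. -/
def tailMap (m : ℕ) : (Fin (m + 1) → ℝ) →ₗ[ℝ] (Fin m → ℝ) := LinearMap.funLeft ℝ ℝ Fin.succ

theorem tailMap_apply {m : ℕ} (x : Fin (m + 1) → ℝ) : tailMap m x = fun i => x i.succ := rfl

/-- The linear map with head coordinate `φ` and remaining coordinates `f`. -/
def consMap {E : Type*} [AddCommGroup E] [Module ℝ E] {m : ℕ} (φ : E →ₗ[ℝ] ℝ)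
    (f : E →ₗ[ℝ] (Fin m → ℝ)) : E →ₗ[ℝ] (Fin (m + 1) → ℝ) :=
  LinearMap.pi (Fin.cons φ fun i => LinearMap.proj i ∘ₗ f)

section consMap

variable {E : Type*} [AddCommGroup E] [Module ℝ E] {m : ℕ} (φ : E →ₗ[ℝ] ℝ)
  (f : E →ₗ[ℝ] (Fin m → ℝ)) (x : E)

@[simp] theorem consMap_zero : consMap φ f x 0 = φ x := rfl

theorem consMap_tail : (fun i : Fin m => consMap φ f x i.succ) = f x := rfl

theorem sumMap_consMap : sumMap (m + 1) (consMap φ f x) = φ x + sumMap m (f x) := by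
  rw [sumMap_succ, consMap_tail, consMap_zero]

theorem consMap_eq_zero (h : consMap φ f x = 0) : φ x = 0 ∧ f x = 0 := by
  refine ⟨congrFun h 0, ?_⟩
  funext i
  exact congrFun h i.succ

end consMap

/-- The map extends vectors by zero. The sum has to be carried along because a letter 1 sees the
earlier vertices only through their coordinate sum. -/
theorem exists_map_of_sublist (σ c : ℝ) {l' l : List Bool} (h : l'.Sublist l) :
    ∃ f : (Fin l'.length → ℝ) →ₗ[ℝ] (Fin l.length → ℝ), ∀ x,
      stringForm σ c l (f x) = stringForm σ c l' x ∧ sumMap _ (f x) = sumMap _ x := by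
  induction h with
  | slnil => exact ⟨LinearMap.id, fun x => ⟨rfl, rfl⟩⟩
  | @cons l₁ l₂ b h ih =>
    obtain ⟨f, hf⟩ := ih
    refine ⟨consMap 0 f, fun x => ⟨?_, ?_⟩⟩
    · rw [stringForm_cons, consMap_tail, (hf x).1]
      simp
    · exact (sumMap_consMap 0 f x).trans (by simp [(hf x).2])
  | @cons_cons l₁ l₂ b h ih =>
    obtain ⟨f, hf⟩ := ih
    let g : (Fin (l₁.length + 1) → ℝ) →ₗ[ℝ] (Fin (l₂.length + 1) → ℝ) :=
      consMap (LinearMap.proj 0) (f ∘ₗ tailMap _)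
    refine ⟨g, fun (x : Fin (l₁.length + 1) → ℝ) => ⟨?_, ?_⟩⟩
    · have h1 := (hf (tailMap _ x)).1
      have h2 := (hf (tailMap _ x)).2
      cases b
      · rw [stringForm_false, stringForm_false, consMap_tail, LinearMap.comp_apply, h1,
          tailMap_apply]
        rfl
      · rw [stringForm_true, stringForm_true, consMap_tail, LinearMap.comp_apply, h1, h2,
          tailMap_apply]
        rfl
    · refine (sumMap_consMap _ _ x).trans ?_
      rw [LinearMap.comp_apply, (hf _).2]
      exact (sumMap_succ x).symm

theorem HasPos.of_sublist {σ c : ℝ} {l' l : List Bool} {d : ℕ}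
    (h : HasPos (stringForm σ c l') d) (hl : l'.Sublist l) : HasPos (stringForm σ c l) d := by
  obtain ⟨f, hf⟩ := exists_map_of_sublist σ c hl
  exact h.transfer f fun x => (hf x).1.ge

/-- Where the dominating vertex has coordinate zero, the vertex of the letter 0 is isolated and
contributes only a nonpositive square. -/
theorem HasPos.of_append_pair {σ c : ℝ} (hc : 0 ≤ c) {l : List Bool} {d : ℕ}
    (h : HasPos (stringForm σ c (true :: false :: l)) (d + 1)) : HasPos (stringForm σ c l) d := by
  let φ : (Fin (l.length + 1 + 1) → ℝ) →ₗ[ℝ] ℝ := LinearMap.proj 0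
  refine h.transfer_ker (tailMap _ ∘ₗ tailMap _) φ fun (x : Fin (l.length + 1 + 1) → ℝ) hx => ?_
  have hx0 : x 0 = 0 := hx
  rw [stringForm_true, hx0, stringForm_false]
  have : 0 ≤ c * x (Fin.succ 0) ^ 2 := by positivity
  simp only [LinearMap.comp_apply, tailMap_apply]
  linarith

/-- With total sum zero the two leaves sum to minus the centre, so the edges contribute -2 (x 0)².
-/
theorem stringForm_path_nonpos {c : ℝ} (hc : 0 ≤ c) (x : Fin 3 → ℝ) (hx : sumMap 3 x = 0) :
    stringForm 1 c [true, false, false] x ≤ 0 := by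
  have h1 : sumMap 2 (fun i => x i.succ) = - x 0 := by
    have := sumMap_succ x
    linarith
  have h2 : stringForm 1 c [true, false, false] x =
      stringForm 1 c [false, false] (fun i => x i.succ) +
        2 * 1 * x 0 * sumMap 2 (fun i => x i.succ) - c * x 0 ^ 2 :=
    stringForm_true 1 c [false, false] x
  have h3 : stringForm 1 c [false, false] (fun i => x i.succ) =
      - c * x 2 ^ 2 - c * x 1 ^ 2 := by
    simp [stringForm]
  rw [h2, h3, h1]
  have := mul_nonneg hc (sq_nonneg (x 0))
  have := mul_nonneg hc (sq_nonneg (x 1))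
  have := mul_nonneg hc (sq_nonneg (x 2))
  nlinarith [sq_nonneg (x 0)]

/-- On a hyperplane, the form of `l'` is dominated by that of `l`, with equal coordinate sums. -/
def PrefixDominated (c : ℝ) (l' l : List Bool) : Prop :=
  ∃ (f : (Fin l'.length → ℝ) →ₗ[ℝ] (Fin l.length → ℝ)) (φ : (Fin l'.length → ℝ) →ₗ[ℝ] ℝ),
    ∀ x, φ x = 0 → stringForm 1 c l' x ≤ stringForm 1 c l (f x) ∧ sumMap _ (f x) = sumMap _ x

/-- A new head interacts with the tail only through the tail's sum, which agrees on both sides. -/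
theorem PrefixDominated.cons {c : ℝ} {l' l : List Bool} (h : PrefixDominated c l' l) (b : Bool) :
    PrefixDominated c (b :: l') (b :: l) := by
  obtain ⟨f, φ, hf⟩ := h
  let g : (Fin (l'.length + 1) → ℝ) →ₗ[ℝ] (Fin (l.length + 1) → ℝ) :=
    consMap (LinearMap.proj 0) (f ∘ₗ tailMap l'.length)
  refine ⟨g, φ ∘ₗ tailMap l'.length, fun (x : Fin (l'.length + 1) → ℝ) hx => ?_⟩
  obtain ⟨h1, h2⟩ := hf (tailMap _ x) hx
  have h0 : g x 0 = x 0 := rfl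
  have ht : (fun i : Fin l.length => g x i.succ) = f (tailMap _ x) := rfl
  refine ⟨?_, ?_⟩
  · cases b
    · rw [stringForm_false, stringForm_false, h0, ht]
      rw [tailMap_apply] at *
      linarith
    · rw [stringForm_true, stringForm_true, h0, ht, h2]
      rw [tailMap_apply] at *
      linarith
  · refine (sumMap_succ (g x)).trans (Eq.trans ?_ (sumMap_succ x).symm)
    rw [h0, ht, h2, tailMap_apply]

theorem prefixDominated_path {c : ℝ} (hc : 0 ≤ c) (l : List Bool) :
    PrefixDominated c (l ++ [true, false, false]) l := by
  induction l with
  | nil =>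
    exact ⟨0, sumMap 3, fun x hx =>
      ⟨stringForm_path_nonpos hc x hx, (map_zero (sumMap 0)).trans hx.symm⟩⟩
  | cons b l ih => exact ih.cons b

theorem HasPos.of_prefix_path {c : ℝ} (hc : 0 ≤ c) {l : List Bool} {d : ℕ}
    (h : HasPos (stringForm 1 c (l ++ [true, false, false])) (d + 1)) :
    HasPos (stringForm 1 c l) d := by
  obtain ⟨f, φ, hf⟩ := prefixDominated_path hc l
  exact h.transfer_ker f φ fun x hx => (hf x hx).1

/-! ### Upper bound for the number of positive eigenvalues -/

/-- The form of `l'` exceeds that of `l` by at most the increase of the squared sum. -/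
def SumDominated (l' l : List Bool) : Prop :=
  ∃ f : (Fin l'.length → ℝ) →ₗ[ℝ] (Fin l.length → ℝ), ∀ x,
    stringForm 1 0 l' x ≤ stringForm 1 0 l (f x) + sumMap _ x ^ 2 - sumMap _ (f x) ^ 2

/-- For head a and tail sum S, 2aS = (a + S)² - S² - a², so the increase of the squared sum pays for
the new cross term. -/
theorem SumDominated.cons {l' l : List Bool} (h : SumDominated l' l) :
    SumDominated (true :: l') l := by
  obtain ⟨f, hf⟩ := h
  refine ⟨f ∘ₗ tailMap l'.length, fun (x : Fin (l'.length + 1) → ℝ) => ?_⟩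
  have h := hf (tailMap _ x)
  have h2 : sumMap (true :: l').length x = x 0 + sumMap l'.length (fun i => x i.succ) :=
    sumMap_succ x
  rw [stringForm_true, LinearMap.comp_apply, h2]
  rw [tailMap_apply] at *
  nlinarith [sq_nonneg (x 0)]

theorem sumDominated_ones (t : ℕ) (l : List Bool) :
    SumDominated (List.replicate t true ++ l) l := by
  induction t with
  | zero =>
    have : SumDominated l l := ⟨LinearMap.id, fun x => by simp⟩
    exact this
  | succ t ih => exact ih.cons

/-- The form of `l'` is at most that of `l`. -/
def Dominated (l' l : List Bool) : Prop :=
  ∃ f : (Fin l'.length → ℝ) →ₗ[ℝ] (Fin l.length → ℝ), ∀ x,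
    stringForm 1 0 l' x ≤ stringForm 1 0 l (f x)

theorem Dominated.cons {l' l : List Bool} (h : Dominated l' l) : Dominated (false :: l') l := by
  obtain ⟨f, hf⟩ := h
  refine ⟨f ∘ₗ tailMap l'.length, fun (x : Fin (l'.length + 1) → ℝ) => ?_⟩
  have h := hf (tailMap _ x)
  rw [stringForm_false, LinearMap.comp_apply]
  rw [tailMap_apply] at *
  linarith

theorem dominated_zeros (s : ℕ) (l : List Bool) :
    Dominated (List.replicate s false ++ l) l := by
  induction s with
  | zero => exact ⟨LinearMap.id, fun x => le_rfl⟩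
  | succ s ih => exact ih.cons

/-- On the hyperplane of total sum zero the squared-sum surplus created by the ones is nonpositive,
so a whole block costs one dimension whatever its size. -/
theorem HasPos.of_append_block {l : List Bool} {s t d : ℕ}
    (h : HasPos (stringForm 1 0 (List.replicate t true ++ (List.replicate s false ++ l))) (d + 1)) :
    HasPos (stringForm 1 0 l) d := by
  obtain ⟨f, hf⟩ := sumDominated_ones t (List.replicate s false ++ l)
  obtain ⟨g, hg⟩ := dominated_zeros s l
  refine h.transfer_ker (g ∘ₗ f) (sumMap _) fun x hx => ?_
  have h1 := hf x
  have h2 := hg (f x)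
  rw [hx] at h1
  rw [LinearMap.comp_apply]
  nlinarith [sq_nonneg (sumMap _ (f x))]

theorem blockString_succ {k : ℕ} (s t : Fin (k + 1) → ℕ) :
    blockString s t = blockString (fun i => s i.castSucc) (fun i => t i.castSucc) ++
      (List.replicate (s (Fin.last k)) false ++ List.replicate (t (Fin.last k)) true) := by
  simp [blockString, List.finRange_succ_last, List.flatMap_map]

theorem not_hasPos_blockString {k : ℕ} (s t : Fin k → ℕ) :
    ¬ HasPos (stringForm 1 0 (blockString s t).reverse) (k + 1) := by
  induction k with
  | zero =>
    rintro ⟨f, hf⟩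
    have := hf 1 one_ne_zero
    exact lt_irrefl _ this
  | succ k ih =>
    intro h
    rw [blockString_succ, List.reverse_append, List.reverse_append, List.reverse_replicate,
      List.reverse_replicate, List.append_assoc] at h
    exact ih _ _ h.of_append_block

/-! ### Alternating strings and their positive index -/

/-- The reversed alternating string. -/
def altRev (n : ℕ) : List Bool := (antiregularString n).reverse

theorem altRev_add_two (n : ℕ) : altRev (n + 2) = true :: false :: altRev n := by
  simp [altRev, antiregularString]

theorem length_altRev (n : ℕ) : (altRev n).length = n := by
  rw [altRev, List.length_reverse, length_antiregularString]

theorem altRev_eq_append (k : ℕ) : altRev (2 * k + 3) = altRev (2 * k) ++ [true, false, false] := by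
  induction k with
  | zero => rfl
  | succ k ih =>
    rw [show 2 * (k + 1) + 3 = (2 * k + 3) + 2 by ring, show 2 * (k + 1) = 2 * k + 2 by ring,
      altRev_add_two, ih, altRev_add_two]
    rfl

theorem HasPos.altRev_of_le {σ c : ℝ} (hc : 0 ≤ c) {k K : ℕ} (hk : k ≤ K)
    (h : HasPos (stringForm σ c (altRev (2 * K + 1))) K) :
    HasPos (stringForm σ c (altRev (2 * k + 1))) k := by
  induction K, hk using Nat.le_induction with
  | base => exact h
  | succ K _ ih =>
    rw [show 2 * (K + 1) + 1 = (2 * K + 1) + 2 by ring, altRev_add_two] at h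
    exact ih (h.of_append_pair hc)

theorem stringForm_zero (σ c : ℝ) (l : List Bool) : stringForm σ c l 0 = 0 := by
  induction l with
  | nil => rfl
  | cons b l ih =>
    change stringForm σ c (b :: l) (0 : Fin (l.length + 1) → ℝ) = 0
    rw [stringForm_cons]
    have : (fun i : Fin l.length => (0 : Fin (l.length + 1) → ℝ) i.succ) = 0 := rfl
    rw [this, ih]
    simp

theorem stringForm_pair (σ c : ℝ) (l : List Bool) (y : Fin (l.length + 1 + 1) → ℝ) :
    stringForm σ c (true :: false :: l) y = stringForm σ c l (fun i => y i.succ.succ) +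
      2 * σ * y 0 * (y (Fin.succ 0) + sumMap l.length (fun i => y i.succ.succ)) -
      c * y (Fin.succ 0) ^ 2 - c * y 0 ^ 2 := by
  have h : sumMap (false :: l).length (fun i => y i.succ) =
      y (Fin.succ 0) + sumMap l.length (fun i => y i.succ.succ) :=
    sumMap_succ (m := l.length) (fun i => y i.succ)
  have h2 : stringForm σ c (false :: l) (fun i => y i.succ) =
      stringForm σ c l (fun i => y i.succ.succ) - c * y (Fin.succ 0) ^ 2 :=
    stringForm_false σ c l fun i => y i.succ
  rw [stringForm_true, h, h2]
  ring

theorem sumMap_pair (l : List Bool) (y : Fin (l.length + 1 + 1) → ℝ) :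
    sumMap (true :: false :: l).length y =
      y 0 + (y (Fin.succ 0) + sumMap l.length (fun i => y i.succ.succ)) :=
  (sumMap_succ y).trans (congrArg _ (sumMap_succ (m := l.length) fun i => y i.succ))

/-- The coordinate of the new 0 is chosen so that all coordinates below the new 1 sum to y 0; the
cross term then becomes 2 (y 0)². -/
theorem HasPos.append_pair {l : List Bool} {d : ℕ} (h : HasPos (stringForm 1 0 l) d) :
    HasPos (stringForm 1 0 (true :: false :: l)) (d + 1) := by
  obtain ⟨f, hf⟩ := h
  let g : (Fin (d + 1) → ℝ) →ₗ[ℝ] (Fin (l.length + 1 + 1) → ℝ) :=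
    consMap (LinearMap.proj 0)
      (consMap (LinearMap.proj 0 - sumMap _ ∘ₗ f ∘ₗ tailMap d) (f ∘ₗ tailMap d))
  refine ⟨g, fun y hy => ?_⟩
  have hform : stringForm 1 0 (true :: false :: l) (g y) =
      stringForm 1 0 l (f (tailMap d y)) + 2 * y 0 ^ 2 := by
    have h0 : g y 0 = y 0 := rfl
    have h1 : g y (Fin.succ 0) = y 0 - sumMap _ (f (tailMap d y)) := rfl
    have h2 : (fun i : Fin l.length => g y i.succ.succ) = f (tailMap d y) := rfl
    rw [stringForm_pair, h0, h1, h2]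
    ring
  rw [hform]
  by_cases ht : tailMap d y = 0
  · have hy0 : y 0 ≠ 0 := by
      intro h0
      apply hy
      funext i
      exact Fin.cases h0 (fun i => congrFun ht i) i
    rw [ht, map_zero, stringForm_zero]
    positivity
  · have := hf _ ht
    positivity

theorem hasPos_altRev (k : ℕ) : HasPos (stringForm 1 0 (altRev (2 * k + 1))) k := by
  induction k with
  | zero => exact ⟨0, fun y hy => absurd (Subsingleton.elim y 0) hy⟩
  | succ k ih =>
    rw [show 2 * (k + 1) + 1 = (2 * k + 1) + 2 by ring, altRev_add_two]
    exact ih.append_pair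

/-! ### Eigenvalues of the alternating string below -1 -/

/-- `-(A + I)` is positive on a `d`-dimensional space of vectors with coordinate sum zero, and
moving along a fixed vector with sum one subtracts a square. -/
def HasNegSystem (l : List Bool) (d : ℕ) : Prop :=
  ∃ (f : (Fin d → ℝ) →ₗ[ℝ] (Fin l.length → ℝ)) (e : Fin l.length → ℝ), sumMap _ e = 1 ∧
    (∀ y, sumMap _ (f y) = 0) ∧ (∀ y, y ≠ 0 → 0 < stringForm (-1) 1 l (f y)) ∧
    ∀ y (h : ℝ), stringForm (-1) 1 l (f y + h • e) = stringForm (-1) 1 l (f y) - h ^ 2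

/-- The new direction has coordinates -2 at the 1, 1 at the 0, and e on the old vertices, so its sum
is -2 + 1 + 1 = 0. Its form is 8 - 4 - 1 - 1 = 2, the last -1 being the square lost along e. The new
e' is the unit vector at the 1: with total sum zero, its cross terms cancel and only -h² remains. -/
theorem HasNegSystem.append_pair {l : List Bool} {d : ℕ} (h : HasNegSystem l d) :
    HasNegSystem (true :: false :: l) (d + 1) := by
  obtain ⟨f, e, he, hs, hpos, hsq⟩ := h
  let p : (Fin (d + 1) → ℝ) →ₗ[ℝ] ℝ := LinearMap.proj 0
  let q : (Fin (d + 1) → ℝ) →ₗ[ℝ] (Fin l.length → ℝ) := f ∘ₗ tailMap d + p.smulRight e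
  let g : (Fin (d + 1) → ℝ) →ₗ[ℝ] (Fin (l.length + 1 + 1) → ℝ) :=
    consMap ((-2 : ℝ) • p) (consMap p q)
  have hq : ∀ y, q y = f (tailMap d y) + y 0 • e := fun y => rfl
  have hg0 : ∀ y, g y 0 = -2 * y 0 := fun y => rfl
  have hg1 : ∀ y, g y (Fin.succ 0) = y 0 := fun y => rfl
  have hgt : ∀ y, (fun i : Fin l.length => g y i.succ.succ) = q y := fun y => rfl
  have hsq0 : ∀ y, sumMap _ (q y) = y 0 := by
    intro y
    rw [hq, map_add, hs, map_smul, he]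
    simp
  have hform : ∀ y, stringForm (-1) 1 (true :: false :: l) (g y) =
      stringForm (-1) 1 l (f (tailMap d y)) + 2 * y 0 ^ 2 := by
    intro y
    rw [stringForm_pair, hg0, hg1, hgt, hsq0, hq, hsq]
    ring
  let e' : Fin (l.length + 1 + 1) → ℝ := Pi.single 0 1
  have he0 : e' 0 = 1 := by simp [e']
  have he1 : e' (Fin.succ 0) = 0 := by simp [e']
  have het : (fun i : Fin l.length => e' i.succ.succ) = 0 := by
    funext i
    simp [e']
  refine ⟨g, e', ?_, fun y => ?_, fun y hy => ?_, fun y h => ?_⟩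
  · rw [sumMap_pair, he0, he1, het, map_zero]
    ring
  · rw [sumMap_pair, hg0, hg1, hgt, hsq0]
    ring
  · rw [hform]
    by_cases ht : tailMap d y = 0
    · have hy0 : y 0 ≠ 0 := by
        intro h0
        apply hy
        funext i
        exact Fin.cases h0 (fun i => congrFun ht i) i
      rw [ht, map_zero, stringForm_zero]
      positivity
    · have := hpos _ ht
      positivity
  · have h0 : (g y + h • e') 0 = g y 0 + h := by simp [he0]
    have h1 : (g y + h • e') (Fin.succ 0) = g y (Fin.succ 0) := by simp [e']
    have ht : (fun i : Fin l.length => (g y + h • e') i.succ.succ) = q y := by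
      rw [← hgt]
      funext i
      simp [e']
    change stringForm (-1) 1 (true :: false :: l) (g y + h • e') =
      stringForm (-1) 1 (true :: false :: l) (g y) - h ^ 2
    rw [stringForm_pair, stringForm_pair, h0, h1, ht, hgt, hsq0, hg0, hg1]
    ring

theorem hasNegSystem_altRev (k : ℕ) : HasNegSystem (altRev (2 * k + 1)) k := by
  induction k with
  | zero =>
    refine ⟨0, fun _ => 1, ?_, fun y => map_zero _,
      fun y hy => absurd (Subsingleton.elim y 0) hy, fun y h => ?_⟩
    · simp [sumMap_apply, length_altRev]
    · change stringForm (-1) 1 [false] (fun i => 0 + h * 1) = stringForm (-1) 1 [false] 0 - h ^ 2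
      simp [stringForm]
  | succ k ih =>
    rw [show 2 * (k + 1) + 1 = (2 * k + 1) + 2 by ring, altRev_add_two]
    exact ih.append_pair

theorem hasPos_neg_altRev (k : ℕ) : HasPos (stringForm (-1) 1 (altRev (2 * k + 1))) k := by
  obtain ⟨f, _, _, _, h, _⟩ := hasNegSystem_altRev k
  exact ⟨f, h⟩

/-! ### Eigenvalues of an arbitrary string below -1 -/

/-- The number of eigenvalues of the graph of `l.reverse` below `-1` is at most `k`, also after
appending ones to the string, and the string contains the alternating string of length `2k+1`. -/
def IsClosedAt (l : List Bool) (k : ℕ) : Prop :=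
  (altRev (2 * k + 1)).Sublist l ∧ ∃ g : (Fin l.length → ℝ) →ₗ[ℝ] (Fin k → ℝ),
    ∀ x, g x = 0 → stringForm (-1) 1 l x ≤ - sumMap _ x ^ 2

/-- As `IsClosedAt`, but the string has a further zero, so that appending a one raises `k`. -/
def IsOpenAt (l : List Bool) (k : ℕ) : Prop :=
  (false :: altRev (2 * k + 1)).Sublist l ∧ ∃ g : (Fin l.length → ℝ) →ₗ[ℝ] (Fin k → ℝ),
    ∀ x, g x = 0 → stringForm (-1) 1 l x ≤ 0

/-- The bound is stable because -S² - 2aS - a² = -(a + S)², for head a and tail sum S. -/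
theorem IsClosedAt.cons_true {l : List Bool} {k : ℕ} (h : IsClosedAt l k) :
    IsClosedAt (true :: l) k := by
  obtain ⟨h1, g, hg⟩ := h
  refine ⟨h1.cons _, g ∘ₗ tailMap l.length, fun (x : Fin (l.length + 1) → ℝ) hx => ?_⟩
  have h := hg _ hx
  have hs : sumMap (true :: l).length x = x 0 + sumMap l.length (fun i => x i.succ) :=
    sumMap_succ x
  rw [stringForm_true, hs]
  rw [tailMap_apply] at h
  linarith

theorem IsClosedAt.cons_false {l : List Bool} {k : ℕ} (h : IsClosedAt l k) :
    IsOpenAt (false :: l) k := by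
  obtain ⟨h1, g, hg⟩ := h
  refine ⟨h1.cons_cons _, g ∘ₗ tailMap l.length, fun (x : Fin (l.length + 1) → ℝ) hx => ?_⟩
  have h := hg _ hx
  rw [stringForm_false]
  rw [tailMap_apply] at h
  nlinarith [sq_nonneg (x 0), sq_nonneg (sumMap l.length (fun i => x i.succ))]

theorem IsOpenAt.cons_false {l : List Bool} {k : ℕ} (h : IsOpenAt l k) :
    IsOpenAt (false :: l) k := by
  obtain ⟨h1, g, hg⟩ := h
  refine ⟨h1.cons _, g ∘ₗ tailMap l.length, fun (x : Fin (l.length + 1) → ℝ) hx => ?_⟩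
  have h := hg _ hx
  rw [stringForm_false]
  rw [tailMap_apply] at h
  nlinarith [sq_nonneg (x 0)]

/-- The additional linear condition is that the tail sum vanish. The cross term then disappears, and
-a² is minus the squared total sum. -/
theorem IsOpenAt.cons_true {l : List Bool} {k : ℕ} (h : IsOpenAt l k) :
    IsClosedAt (true :: l) (k + 1) := by
  obtain ⟨h1, g, hg⟩ := h
  refine ⟨?_, consMap (sumMap _) g ∘ₗ tailMap l.length,
    fun (x : Fin (l.length + 1) → ℝ) hx => ?_⟩
  · rw [show 2 * (k + 1) + 1 = (2 * k + 1) + 2 by ring, altRev_add_two]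
    exact h1.cons_cons _
  · obtain ⟨h2, h3⟩ := consMap_eq_zero _ _ _ hx
    have h := hg _ h3
    have hs : sumMap (true :: l).length x = x 0 + sumMap l.length (fun i => x i.succ) :=
      sumMap_succ x
    rw [stringForm_true, hs]
    rw [tailMap_apply] at h h2
    rw [h2]
    linarith

/-- The state alternates as letters are read: a 0 opens, and the next 1 closes and raises k. The
final `false` belongs to the first vertex, whose letter is irrelevant to the graph. -/
theorem exists_isClosedAt_or_isOpenAt (l : List Bool) :
    ∃ k, IsClosedAt (l ++ [false]) k ∨ IsOpenAt (l ++ [false]) k := by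
  induction l with
  | nil =>
    refine ⟨0, Or.inl ⟨List.Sublist.refl _, 0, fun x _ => ?_⟩⟩
    change stringForm (-1) 1 [false] x ≤ - sumMap 1 x ^ 2
    simp [stringForm, sumMap_apply]
  | cons b l ih =>
    obtain ⟨k, h | h⟩ := ih <;> cases b
    · exact ⟨k, Or.inr h.cons_false⟩
    · exact ⟨k, Or.inl h.cons_true⟩
    · exact ⟨k, Or.inr h.cons_false⟩
    · exact ⟨k + 1, Or.inl h.cons_true⟩

theorem exists_altRev_sublist_and_not_hasPos (l : List Bool) :
    ∃ k, (altRev (2 * k + 1)).Sublist (l ++ [false]) ∧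
      ¬ HasPos (stringForm (-1) 1 (l ++ [false])) (k + 1) := by
  obtain ⟨k, ⟨h1, g, hg⟩ | ⟨h1, g, hg⟩⟩ := exists_isClosedAt_or_isOpenAt l
  · refine ⟨k, h1, fun h => ?_⟩
    have := h.le_of_ker g fun x hx => (hg x hx).trans (by nlinarith [sq_nonneg (sumMap _ x)])
    omega
  · refine ⟨k, (List.sublist_cons_self _ _).trans h1, fun h => ?_⟩
    have := h.le_of_ker g hg
    omega

/-! ### Alternating subsequences of block strings -/

theorem pair_sublist_block {s t : ℕ} (hs : 1 ≤ s) (ht : 1 ≤ t) :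
    [false, true].Sublist (List.replicate s false ++ List.replicate t true) := by
  have h1 : [false].Sublist (List.replicate s false) := List.replicate_sublist_replicate _ |>.2 hs
  have h2 : [true].Sublist (List.replicate t true) := List.replicate_sublist_replicate _ |>.2 ht
  exact h1.append h2

theorem antiregularString_sublist_blockString {k : ℕ} (s t : Fin k → ℕ) (hs : ∀ i, 1 ≤ s i)
    (ht : ∀ i, 1 ≤ t i) : (antiregularString (2 * k)).Sublist (blockString s t) := by
  induction k with
  | zero => exact List.nil_sublist _
  | succ k ih =>
    rw [blockString_succ]
    exact (ih _ _ (fun _ => hs _) fun _ => ht _).append (pair_sublist_block (hs _) (ht _))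

/-- The second zero of the first block supplies the doubled initial 0 of the odd alternating string.
-/
theorem antiregularString_sublist_blockString_of_two_le {k : ℕ} (s t : Fin (k + 1) → ℕ)
    (hs : ∀ i, 1 ≤ s i) (ht : ∀ i, 1 ≤ t i) (h2 : 2 ≤ s 0) :
    (antiregularString (2 * (k + 1) + 1)).Sublist (blockString s t) := by
  induction k with
  | zero =>
    rw [blockString_succ]
    have h1 : [false, false].Sublist (List.replicate (s 0) false) :=
      List.replicate_sublist_replicate _ |>.2 h2
    have h2 : [true].Sublist (List.replicate (t 0) true) :=
      List.replicate_sublist_replicate _ |>.2 (ht 0)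
    exact (h1.append h2).trans (List.sublist_append_right _ _)
  | succ k ih =>
    rw [blockString_succ]
    exact (ih (fun i => s i.castSucc) (fun i => t i.castSucc) (fun _ => hs _) (fun _ => ht _)
      h2).append (pair_sublist_block (hs _) (ht _))

/-! ### From graphs to strings -/

open scoped Matrix

open Classical in
/-- The real adjacency matrix of a graph. -/
noncomputable def realAdj {V : Type*} [Fintype V] (G : SimpleGraph V) : Matrix V V ℝ :=
  G.adjMatrix ℝ

open Classical in
/-- The matrix `-(A + I)`, whose positive eigenvalues are the `-(y + 1)` for `y < -1` an
eigenvalue of `A`. -/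
noncomputable def coAdj {V : Type*} [Fintype V] (G : SimpleGraph V) : Matrix V V ℝ :=
  -realAdj G - 1

/-- The equivalence `e` identifies `G` with the graph of the string `l.reverse`, with the vertices
in reverse order. -/
def IsStringOrder {V : Type*} (G : SimpleGraph V) (l : List Bool) (e : V ≃ Fin l.length) : Prop :=
  ∀ u v, G.Adj u v ↔ u ≠ v ∧ l.get (min (e u) (e v)) = true

theorem sum_sum_eq_stringForm (l : List Bool) (x : Fin l.length → ℝ) :
    ∑ i, ∑ j, (if i ≠ j ∧ l.get (min i j) = true then x i * x j else 0) = stringForm 1 0 l x := by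
  induction l with
  | nil => rfl
  | cons b l ih =>
    have key : ∀ y : Fin (l.length + 1) → ℝ, ∑ i : Fin (l.length + 1), ∑ j : Fin (l.length + 1),
        (if i ≠ j ∧ (b :: l).get (min i j) = true then y i * y j else 0) =
          stringForm 1 0 (b :: l) y := by
      intro y
      have h0 : ∀ i : Fin l.length, min i.succ 0 = 0 := fun i => min_eq_right (Fin.zero_le _)
      have h0' : ∀ i : Fin l.length, min 0 i.succ = 0 := fun i => min_eq_left (Fin.zero_le _)
      have hs : ∀ i j : Fin l.length, min i.succ j.succ = (min i j).succ := fun i j =>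
        (Fin.strictMono_succ.monotone.map_min).symm
      have hb : (b :: l).get (0 : Fin (l.length + 1)) = b := rfl
      have hl : ∀ i : Fin l.length, (b :: l).get (i.succ : Fin (l.length + 1)) = l.get i :=
        fun i => rfl
      simp only [Fin.sum_univ_succ, Finset.sum_add_distrib, h0, h0', hs, hb, hl, ne_eq,
        Fin.succ_inj, Fin.succ_ne_zero, (Fin.succ_ne_zero _).symm, not_false_eq_true, true_and,
        not_true_eq_false, false_and, if_false]
      have ih' := ih fun i => y i.succ
      simp only [ne_eq] at ih'
      rw [ih', stringForm_cons]
      cases b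
      · simp
      · simp only [if_true, Finset.mul_sum, zero_mul, zero_add, sub_zero]
        rw [← add_assoc, ← Finset.sum_add_distrib, add_comm]
        congr 1
        refine Finset.sum_congr rfl fun i _ => ?_
        ring
    exact key x

theorem stringForm_eq (σ c : ℝ) (l : List Bool) (x : Fin l.length → ℝ) :
    stringForm σ c l x = σ * stringForm 1 0 l x - c * ∑ i, x i * x i := by
  induction l with
  | nil => simp [stringForm]
  | cons b l ih =>
    have key : ∀ y : Fin (l.length + 1) → ℝ, stringForm σ c (b :: l) y =
        σ * stringForm 1 0 (b :: l) y - c * ∑ i : Fin (l.length + 1), y i * y i := by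
      intro y
      rw [stringForm_cons, stringForm_cons, ih, Fin.sum_univ_succ]
      cases b
      · simp only [Bool.false_eq_true, if_false]
        ring
      · simp only [if_true]
        ring
    exact key x

section order

variable {V : Type*} {G : SimpleGraph V}

theorem HasPos.comp_equiv_iff {l : List Bool} {e : V ≃ Fin l.length} {F : (V → ℝ) → ℝ} {F' : (Fin l.length → ℝ) → ℝ}
    (hF : ∀ x, F x = F' (x ∘ e.symm)) (d : ℕ) : HasPos F d ↔ HasPos F' d := by
  constructor
  · intro h
    exact h.transfer (LinearMap.funLeft ℝ ℝ e.symm) fun x => (hF x).le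
  · intro h
    refine h.transfer (LinearMap.funLeft ℝ ℝ e) fun x => ?_
    rw [hF]
    refine le_of_eq (congrArg F' ?_)
    funext i
    simp [LinearMap.funLeft_apply]

/-- Reversing the order of the vertices turns the maximum of two positions into the minimum. -/
theorem exists_isStringOrder_of_iso {b : List Bool} (h : Nonempty (G ≃g stringGraph b)) :
    ∃ e, IsStringOrder G b.reverse e := by
  obtain ⟨φ⟩ := h
  refine ⟨φ.toEquiv.trans (Fin.revPerm.trans (finCongr b.length_reverse.symm)), fun u v => ?_⟩
  rw [← φ.map_adj_iff]
  change _ ∧ _ ↔ _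
  have h1 : φ u ≠ φ v ↔ u ≠ v := φ.injective.ne_iff
  rw [h1]
  refine and_congr_right fun _ => ?_
  have h2 : ∀ i j : Fin b.length, b.reverse.get
      (min (finCongr b.length_reverse.symm i.rev) (finCongr b.length_reverse.symm j.rev)) =
      b.get (max i j) := by
    intro i j
    have h3 : min (finCongr b.length_reverse.symm i.rev) (finCongr b.length_reverse.symm j.rev) =
        finCongr b.length_reverse.symm (max i j).rev := by
      apply Fin.ext
      rcases le_total i j with h | h
      · have h' : (i : ℕ) ≤ j := h
        simp [max_eq_right h, Fin.val_rev]
        omega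
      · have h' : (j : ℕ) ≤ i := h
        simp [max_eq_left h, Fin.val_rev]
        omega
    rw [h3]
    have hlt := (max i j).isLt
    simp only [List.get_eq_getElem, finCongr_apply, Fin.val_cast, List.getElem_reverse,
      Fin.val_rev]
    congr 1
    omega
  exact (congrArg (· = true) (h2 (φ u) (φ v))).symm.to_iff

/-- In a threshold graph every nonempty set of vertices can be ordered so that each vertex is
joined to all or none of the later ones. -/
theorem exists_order_of_adj_iff_lt {w : V → ℝ} {t : ℝ}
    (hG : ∀ u v, u ≠ v → (G.Adj u v ↔ t < w u + w v)) (m : ℕ) (X : Finset V)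
    (hX : X.card = m + 1) :
    ∃ (l : List Bool) (p : Fin (l ++ [false]).length → V), Function.Injective p ∧
      (∀ v, v ∈ X ↔ v ∈ Set.range p) ∧
      ∀ i j, G.Adj (p i) (p j) ↔ i ≠ j ∧ (l ++ [false]).get (min i j) = true := by
  classical
  induction m generalizing X with
  | zero =>
    obtain ⟨v, rfl⟩ := Finset.card_eq_one.1 hX
    refine ⟨[], fun _ => v, fun (i j : Fin 1) _ => Subsingleton.elim i j, fun u => ?_,
      fun (i j : Fin 1) => ?_⟩
    · simp only [Finset.mem_singleton, Set.mem_range]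
      exact ⟨fun h => ⟨(0 : Fin 1), h.symm⟩, fun ⟨_, h⟩ => h.symm⟩
    · simp [Subsingleton.elim i j]
  | succ m ih =>
    have hstep : ∃ (v : V) (b : Bool), v ∈ X ∧ ∀ x ∈ X, x ≠ v → (G.Adj v x ↔ b = true) := by
      have hne : X.Nonempty := Finset.card_pos.1 (by omega)
      obtain ⟨u, hu, hmax⟩ := X.exists_max_image w hne
      have hne' : (X.erase u).Nonempty := Finset.card_pos.1 (by
        rw [Finset.card_erase_of_mem hu]
        omega)
      obtain ⟨v, hv, hmin⟩ := (X.erase u).exists_min_image w hne'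
      obtain ⟨hvu, hvX⟩ := Finset.mem_erase.1 hv
      -- Here u is heaviest and v lightest among the rest. If they are adjacent, u is joined to
      -- every other vertex of X; otherwise v is joined to none.
      by_cases h : t < w u + w v
      · refine ⟨u, true, hu, fun x hx hxu => ?_⟩
        rw [hG u x hxu.symm]
        have := hmin x (Finset.mem_erase.2 ⟨hxu, hx⟩)
        simp only [iff_true]
        linarith
      · refine ⟨v, false, hvX, fun x hx hxv => ?_⟩
        rw [hG v x hxv.symm]
        have := hmax x hx
        simp only [Bool.false_eq_true, iff_false, not_lt]
        linarith
    obtain ⟨v, b, hv, hb⟩ := hstep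
    obtain ⟨l, p, hp, hr, hadj⟩ := ih (X.erase v) (by
      rw [Finset.card_erase_of_mem hv]
      omega)
    have hpX : ∀ i, p i ∈ X ∧ p i ≠ v := fun i => by
      have := (hr (p i)).2 ⟨i, rfl⟩
      rw [Finset.mem_erase] at this
      exact this.symm
    let q : Fin ((l ++ [false]).length + 1) → V := Fin.cons v p
    refine ⟨b :: l, q, ?_, fun u => ?_, ?_⟩
    · refine Fin.cons_injective_iff.2 ⟨?_, hp⟩
      rintro ⟨i, hi⟩
      exact (hpX i).2 hi
    · change _ ↔ u ∈ Set.range q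
      rw [Fin.range_cons, Set.mem_insert_iff, ← hr, Finset.mem_erase]
      constructor
      · intro h
        by_cases huv : u = v
        · exact Or.inl huv
        · exact Or.inr ⟨huv, h⟩
      · rintro (rfl | h)
        · exact hv
        · exact h.2
    · have key : ∀ i j : Fin ((l ++ [false]).length + 1), G.Adj (q i) (q j) ↔
          i ≠ j ∧ (b :: (l ++ [false])).get (min i j) = true := by
        intro i j
        cases i using Fin.cases with
        | zero =>
          cases j using Fin.cases with
          | zero => simp
          | succ j =>
            rw [min_eq_left (Fin.zero_le _)]
            have h1 := hb (p j) (hpX j).1 (hpX j).2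
            exact h1.trans ⟨fun h => ⟨(Fin.succ_ne_zero _).symm, h⟩, fun h => h.2⟩
        | succ i =>
          cases j using Fin.cases with
          | zero =>
            rw [min_eq_right (Fin.zero_le _), G.adj_comm]
            have h1 := hb (p i) (hpX i).1 (hpX i).2
            exact h1.trans ⟨fun h => ⟨Fin.succ_ne_zero _, h⟩, fun h => h.2⟩
          | succ j =>
            rw [← Fin.strictMono_succ.monotone.map_min, Ne, Fin.succ_inj]
            exact hadj i j
      exact key

end order

section spectrum

variable {V : Type*} [Fintype V] {G : SimpleGraph V}

theorem realAdj_isSymm : (realAdj G).IsSymm := by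
  classical
  exact SimpleGraph.isSymm_adjMatrix _

theorem coAdj_isSymm : (coAdj G).IsSymm := by
  classical
  rw [coAdj, Matrix.IsSymm, Matrix.transpose_sub, Matrix.transpose_neg, realAdj_isSymm,
    Matrix.transpose_one]

theorem isGraphEigenvalue_iff {x : ℝ} : IsGraphEigenvalue G x ↔ (realAdj G).HasEig x := by
  classical
  exact Matrix.hasEigenvalue_toLin'_iff _ _

theorem coAdj_hasEig_iff {x : ℝ} : (coAdj G).HasEig x ↔ (realAdj G).HasEig (-1 - x) := by
  have h : ∀ v : V → ℝ, coAdj G *ᵥ v = x • v ↔ realAdj G *ᵥ v = (-1 - x) • v := by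
    classical
    intro v
    rw [coAdj, Matrix.sub_mulVec, Matrix.neg_mulVec, Matrix.one_mulVec]
    constructor
    · intro h
      funext i
      have := congrFun h i
      simp only [Pi.sub_apply, Pi.neg_apply, Pi.smul_apply, smul_eq_mul] at this ⊢
      linarith
    · intro h
      funext i
      have := congrFun h i
      simp only [Pi.sub_apply, Pi.neg_apply, Pi.smul_apply, smul_eq_mul] at this ⊢
      linarith
  simp only [Matrix.HasEig, h]

theorem isMuPlus_iff {a : ℝ} :
    IsMuPlus G a ↔ IsLeast {μ | (realAdj G).HasEig μ ∧ 0 < μ} a := by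
  simp only [IsMuPlus, isGraphEigenvalue_iff]

/-- The reflection y ↦ -1 - y reverses the order, turning a greatest eigenvalue below -1 into a
least positive one. -/
theorem isMuMinus_iff {a : ℝ} :
    IsMuMinus G a ↔ IsLeast {μ | (coAdj G).HasEig μ ∧ 0 < μ} (-1 - a) := by
  simp only [IsMuMinus, isGraphEigenvalue_iff, IsGreatest, IsLeast, upperBounds, lowerBounds,
    Set.mem_ofPred_eq, coAdj_hasEig_iff, sub_sub_cancel]
  constructor
  · rintro ⟨⟨h1, h2⟩, h3⟩
    refine ⟨⟨h1, by linarith⟩, fun x hx => ?_⟩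
    have := h3 ⟨hx.1, by linarith⟩
    linarith
  · rintro ⟨⟨h1, h2⟩, h3⟩
    refine ⟨⟨h1, by linarith⟩, fun x hx => ?_⟩
    have := @h3 (-1 - x) ⟨by simpa using hx.1, by linarith⟩
    linarith

namespace IsStringOrder

variable {l : List Bool} {e : V ≃ Fin l.length}

theorem dotProduct_realAdj (h : IsStringOrder G l e) (x : V → ℝ) :
    x ⬝ᵥ realAdj G *ᵥ x = stringForm 1 0 l (x ∘ e.symm) := by
  classical
  rw [← sum_sum_eq_stringForm, ← e.sum_comp]
  refine Finset.sum_congr rfl fun u _ => ?_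
  rw [← e.sum_comp, Matrix.mulVec, dotProduct, Finset.mul_sum]
  refine Finset.sum_congr rfl fun v _ => ?_
  simp only [realAdj, SimpleGraph.adjMatrix_apply, h u v, Function.comp_apply,
    Equiv.symm_apply_apply, ne_eq, EmbeddingLike.apply_eq_iff_eq]
  split_ifs <;> simp

theorem shiftForm_realAdj (h : IsStringOrder G l e) (c : ℝ) (x : V → ℝ) :
    (realAdj G).shiftForm c x = stringForm 1 c l (x ∘ e.symm) := by
  rw [Matrix.shiftForm, h.dotProduct_realAdj, stringForm_eq 1 c, one_mul, dotProduct,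
    ← e.symm.sum_comp]
  rfl

theorem shiftForm_coAdj (h : IsStringOrder G l e) (c : ℝ) (x : V → ℝ) :
    (coAdj G).shiftForm c x = stringForm (-1) (1 + c) l (x ∘ e.symm) := by
  classical
  have h1 : x ⬝ᵥ x = ∑ i, (x ∘ e.symm) i * (x ∘ e.symm) i := by
    rw [dotProduct, ← e.symm.sum_comp]
    rfl
  rw [Matrix.shiftForm, coAdj, Matrix.sub_mulVec, Matrix.neg_mulVec, Matrix.one_mulVec,
    dotProduct_sub, dotProduct_neg, h.dotProduct_realAdj, stringForm_eq (-1) (1 + c), h1]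
  ring

theorem hasPos_realAdj_iff (h : IsStringOrder G l e) (c : ℝ) (d : ℕ) :
    HasPos ((realAdj G).shiftForm c) d ↔ HasPos (stringForm 1 c l) d :=
  HasPos.comp_equiv_iff (h.shiftForm_realAdj c) d

theorem hasPos_coAdj_iff (h : IsStringOrder G l e) (c : ℝ) (d : ℕ) :
    HasPos ((coAdj G).shiftForm c) d ↔ HasPos (stringForm (-1) (1 + c) l) d :=
  HasPos.comp_equiv_iff (h.shiftForm_coAdj c) d

end IsStringOrder

theorem exists_isStringOrder_antiregularGraph (n : ℕ) :
    ∃ e, IsStringOrder (antiregularGraph n) (altRev n) e :=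
  exists_isStringOrder_of_iso ⟨SimpleGraph.Iso.refl⟩

/-- Testing independence on two-element sets shows that distinct vertices are adjacent exactly when
their weights sum to more than t; this is all that the ordering needs. -/
theorem IsThreshold.exists_isStringOrder [Nonempty V] (h : IsThreshold G) :
    ∃ (l : List Bool) (e : V ≃ Fin (l ++ [false]).length), IsStringOrder G (l ++ [false]) e := by
  classical
  obtain ⟨w, -, t, -, hX⟩ := h
  have hG : ∀ u v, u ≠ v → (G.Adj u v ↔ t < w u + w v) := by
    intro u v huv
    have h1 := hX {u, v}
    rw [Finset.sum_pair huv, ← not_iff_not] at h1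
    have h2 : G.IsIndepSet (({u, v} : Finset V) : Set V) ↔ ¬ G.Adj u v := by
      rw [SimpleGraph.isIndepSet_iff, Finset.coe_pair]
      refine ⟨fun h => h (Set.mem_insert _ _) (Set.mem_insert_of_mem _ rfl) huv, ?_⟩
      rintro h a (rfl | rfl) b (rfl | rfl) hab
      · exact absurd rfl hab
      · exact h
      · exact fun h' => h h'.symm
      · exact absurd rfl hab
    rw [h2, not_not, not_le] at h1
    exact h1
  obtain ⟨m, hm⟩ := Nat.exists_eq_add_one.2 (Fintype.card_pos (α := V))
  obtain ⟨l, p, hp, hr, hadj⟩ := exists_order_of_adj_iff_lt hG m Finset.univ hm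
  have hs : Function.Surjective p := fun v => (hr v).1 (Finset.mem_univ v)
  let e := Equiv.ofBijective p ⟨hp, hs⟩
  refine ⟨l, e.symm, fun u v => ?_⟩
  have h1 := hadj (e.symm u) (e.symm v)
  have h2 : ∀ u, p (e.symm u) = u := e.apply_symm_apply
  rw [h2, h2, e.symm.injective.ne_iff] at h1
  exact h1

end spectrum

/-! ### Comparison with the anti-regular graph -/

theorem exists_isMuPlus {V : Type*} [Fintype V] {G : SimpleGraph V}
    (h : HasPos ((realAdj G).shiftForm 0) 1) : ∃ a, IsMuPlus G a := by
  obtain ⟨a, ha⟩ := Matrix.exists_isLeast_pos_hasEig realAdj_isSymm h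
  exact ⟨a, isMuPlus_iff.2 ha⟩

theorem exists_isMuMinus {V : Type*} [Fintype V] {G : SimpleGraph V}
    (h : HasPos ((coAdj G).shiftForm 0) 1) : ∃ a, IsMuMinus G a := by
  obtain ⟨a, ha⟩ := Matrix.exists_isLeast_pos_hasEig coAdj_isSymm h
  refine ⟨-1 - a, isMuMinus_iff.2 ?_⟩
  rwa [sub_sub_cancel]

/-- The comparison of the least positive eigenvalues of `A_{2K+1}` and of a graph with `k` blocks,
reduced to a comparison of quadratic forms of strings. -/
theorem exists_isMuPlus_le {V : Type*} [Fintype V] {G : SimpleGraph V} {l : List Bool}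
    {e : V ≃ Fin l.length} (he : IsStringOrder G l e) {K k : ℕ} (hK : 0 < K) (hk : 0 < k)
    (hcomp : ∀ c, 0 ≤ c → HasPos (stringForm 1 c (altRev (2 * K + 1))) K →
      HasPos (stringForm 1 c l) k)
    (hl : ¬ HasPos (stringForm 1 0 l) (k + 1)) :
    ∃ a g : ℝ, IsMuPlus (antiregularGraph (2 * K + 1)) a ∧ IsMuPlus G g ∧ a ≤ g := by
  obtain ⟨e', he'⟩ := exists_isStringOrder_antiregularGraph (2 * K + 1)
  have hA := (he'.hasPos_realAdj_iff 0 K).2 (hasPos_altRev K)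
  obtain ⟨a, ha⟩ := exists_isMuPlus (hA.mono hK)
  -- The comparison at shift 0 gives existence of μ⁺(G), as k is positive.
  have hG := (he.hasPos_realAdj_iff 0 k).2 (hcomp 0 le_rfl (hasPos_altRev K))
  obtain ⟨g, hg⟩ := exists_isMuPlus (hG.mono hk)
  refine ⟨a, g, ha, hg, ?_⟩
  have hg' := isMuPlus_iff.1 hg
  refine Matrix.least_pos_le_of_hasPos realAdj_isSymm realAdj_isSymm hA (k := k)
    (fun c hc h => ?_) ?_ (isMuPlus_iff.1 ha) hg'.1.1 hg'.1.2
  · rw [he.hasPos_realAdj_iff]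
    exact hcomp c hc.le ((he'.hasPos_realAdj_iff c K).1 h)
  · rwa [he.hasPos_realAdj_iff]

theorem exists_isMuMinus_antiregularGraph_ge {V : Type*} [Fintype V] {G : SimpleGraph V} {K : ℕ}
    (hK : 0 < K) (hV : Fintype.card V = 2 * K + 1) (hG : IsThreshold G) :
    ∃ a : ℝ, IsMuMinus (antiregularGraph (2 * K + 1)) a ∧ ∀ g : ℝ, IsMuMinus G g → g ≤ a := by
  have : Nonempty V := Fintype.card_pos_iff.1 (by omega)
  obtain ⟨l, e, he⟩ := hG.exists_isStringOrder
  obtain ⟨k, hsub, hk⟩ := exists_altRev_sublist_and_not_hasPos l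
  have hkK : k ≤ K := by
    have h1 := hsub.length_le
    have h2 := Fintype.card_congr e
    rw [Fintype.card_fin] at h2
    rw [length_altRev] at h1
    omega
  obtain ⟨e', he'⟩ := exists_isStringOrder_antiregularGraph (2 * K + 1)
  have hA : HasPos ((coAdj (antiregularGraph (2 * K + 1))).shiftForm 0) K := by
    rw [he'.hasPos_coAdj_iff, add_zero]
    exact hasPos_neg_altRev K
  obtain ⟨a, ha⟩ := exists_isMuMinus (hA.mono hK)
  refine ⟨a, ha, fun g hg => ?_⟩
  have hg' := isMuMinus_iff.1 hg
  have h := Matrix.least_pos_le_of_hasPos coAdj_isSymm coAdj_isSymm hA (k := k)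
    (fun c hc h => ?_) ?_ (isMuMinus_iff.1 ha) hg'.1.1 hg'.1.2
  · linarith
  · rw [he.hasPos_coAdj_iff]
    rw [he'.hasPos_coAdj_iff] at h
    -- Shifting -(A + I) by c is the string form with parameter 1 + c, so the positivity required is
    -- that of 1 + c.
    exact (h.altRev_of_le (by linarith) hkK).of_sublist hsub
  · rwa [he.hasPos_coAdj_iff, add_zero]

theorem theorem4p6 (n : ℕ) (hn : 3 ≤ n) (hodd : Odd n)
    {V : Type*} [Fintype V] (hV : Fintype.card V = n) (G : SimpleGraph V) :
    (IsThreshold G →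
      ∃ a : ℝ, IsMuMinus (antiregularGraph n) a ∧ ∀ g : ℝ, IsMuMinus G g → g ≤ a) ∧
    (∀ (k : ℕ) (hk : 0 < k) (s t : Fin k → ℕ), (∀ i, 1 ≤ s i) → (∀ i, 1 ≤ t i) →
      Nonempty (G ≃g stringGraph (blockString s t)) →
      2 ≤ s ⟨0, hk⟩ →
      ∃ a g : ℝ, IsMuPlus (antiregularGraph n) a ∧ IsMuPlus G g ∧ a ≤ g) ∧
    (∀ (k : ℕ) (hk : 0 < k) (s t : Fin k → ℕ), (∀ i, 1 ≤ s i) → (∀ i, 1 ≤ t i) →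
      Nonempty (G ≃g stringGraph (blockString s t)) →
      s ⟨0, hk⟩ = 1 → 2 * k + 1 < n →
      ∃ a g : ℝ, IsMuPlus (antiregularGraph n) a ∧ IsMuPlus G g ∧ a ≤ g) := by
  obtain ⟨K, rfl⟩ := hodd
  have hK : 0 < K := by omega
  refine ⟨exists_isMuMinus_antiregularGraph_ge hK hV, ?_, ?_⟩
  · intro k hk s t hs ht hiso h2
    obtain ⟨e, he⟩ := exists_isStringOrder_of_iso hiso
    obtain ⟨k, rfl⟩ := Nat.exists_eq_add_one.2 hk
    have hsub := (antiregularString_sublist_blockString_of_two_le s t hs ht h2).reverse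
    have hkK : k + 1 ≤ K := by
      have h1 := hsub.length_le
      have h2 := Fintype.card_congr e
      rw [Fintype.card_fin] at h2
      rw [List.length_reverse, length_antiregularString] at h1
      omega
    exact exists_isMuPlus_le he hK hk (fun c hc h => (h.altRev_of_le hc hkK).of_sublist hsub)
      (not_hasPos_blockString s t)
  · intro k hk s t hs ht hiso _ hkn
    obtain ⟨e, he⟩ := exists_isStringOrder_of_iso hiso
    have hsub := (antiregularString_sublist_blockString s t hs ht).reverse
    refine exists_isMuPlus_le he hK hk (fun c hc h => ?_) (not_hasPos_blockString s t)
    -- Since 2k + 1 < 2K + 1, one extra pair is available; its dimension is then spent on removing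
    -- the initial path.
    have h1 := h.altRev_of_le hc (k := k + 1) (by omega)
    rw [show 2 * (k + 1) + 1 = 2 * k + 3 by ring, altRev_eq_append] at h1
    exact (h1.of_prefix_path hc).of_sublist hsub
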